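/- Let $V\subseteq H\equiv H^*\subseteq V^*$ be a Gelfand triple ($H$ a real separable Hilbert space, $V$ a reflexive Banach space embedded continuously and densely into $H$). Let $(\Omega,\mathcal F,\mathbb P,(\theta_t)_{t\in\mathbb R})$ be a metric dynamical system (that is, $(t,\omega)\mapsto\theta_t\omega$ is measurable, $\theta_0=\mathrm{id}$, $\theta_{t+s}=\theta_t\circ\theta_s$, and each $\theta_t$ preserves the probability measure $\mathbb P$) carrying a two-sided real Brownian motion $\beta$ with continuous paths, $\beta_0=0$ and $\beta_t(\theta_s\omega)=\beta_{t+s}(\omega)-\beta_s(\omega)$; for example, the canonical Wiener space with the Wiener shift. Let $\mu\in\mathbb R$ and let $A:\mathbb R\times V\times\Omega\to V^*$ be $(\mathcal B(\mathbb R)\otimes\mathcal B(V)\otimes\mathcal F,\mathcal B(V^*))$-measurable and strictly stationary, i.e. $A(t,v;\omega)=A(0,v;\theta_t\omega)$. Assume that there are $\alpha\in(1,2)$, pathwise right-continuous $C_1,C_2:\mathbb R\times\Omega\to\mathbb R$ and $c:\mathbb R\times\Omega\to(0,\infty)$, and $f:\mathbb R\times\Omega\to\mathbb R$ with $f(\cdot,\omega)\in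 L^1_{loc}(\mathbb R)$, such that for all $t\in\mathbb R$, $\omega\in\Omega$ and $v,v_1,v_2\in V$: * (A1) $r\mapsto {}_{V^*}\langle A(t,v_1+rv_2;\omega),v\rangle_V$ is continuous on $\mathbb R$; * (A2) $2\,{}_{V^*}\langle A(t,v_1;\omega)-A(t,v_2;\omega),v_1-v_2\rangle_V\le C_2(t,\omega)\|v_1-v_2\|_H^2$; * (A3) $2\,{}_{V^*}\langle A(t,v;\omega),v\rangle_V\le C_1(t,\omega)\|v\|_H^2-c(t,\omega)\|v\|_V^\alpha+f(t,\omega)$; * (A4) $\|A(t,v;\omega)\|_{V^*}^{\alpha/(\alpha-1)}\le C_1(t,\omega)\|v\|_H^2+C_2(t,\omega)\|v\|_V^\alpha+f(t,\omega)$. Assume moreover that there are $\lambda:\Omega\to(0,\infty)$ and $0<p<2$ with $${}_{V^*}\langle A(t,v;\omega),v\rangle_V\le-\lambda(\omega)\|v\|_H^p\qquad\text{for all }t\in\mathbb R,\ v\in V,\ \omega\in\Omega .$$ Put $\mu_t:=e^{-\mu\beta_t}$. A solution of $dX_t=A(t,X_t)\,dt+\mu X_t\circ d\beta_t$ started at time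 $s$ in $x\in H$ is understood pathwise, as $X_t=\mu_t^{-1}Z_t$, $t\ge s$, where $Z\in C([s,\infty);H)\cap L^\alpha_{loc}([s,\infty);V)$, $r\mapsto\mu_rA(r,\mu_r^{-1}Z_r)$ is locally Bochner integrable on $[s,\infty)$ with values in $V^*$, and $Z_t=\mu_sx+\int_s^t\mu_rA(r,\mu_r^{-1}Z_r)\,dr$ in $V^*$ for all $t\ge s$. The associated flow is the family of maps $S(t,s;\omega):H\to H$, $s\le t$, such that $S(\cdot,s;\omega)x$ is a solution at $\omega$ started at time $s$ in $x$, for all $s,\omega,x$; put $\varphi(t,\omega):=S(t,0;\omega)$ for $t\ge0$. For bounded $B\subseteq H$ let $\|B\|_H:=\sup_{b\in B}\|b\|_H$. 1. There is a function $t_0=t_0(R,s,\omega)$ such that for $\mathbb P$-almost every $\omega$ and every $s\in\mathbb R$: for every $R$, every solution at $\omega$ started at time $s$ in a point $x$ with $\|x\|_H\le R$ vanishes at all times $t\ge\max(s,t_0(R,s,\omega))$. In particular $\{0\}$ is forward-absorbing: for such $\omega$ and $s$ and every bounded $B\subseteq H$, $S(t,s;\omega)B\subseteq\{0\}$ for all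 $t\ge\max(s,t_0(\|B\|_H,s,\omega))$. 2. If $A(t,0;\omega)=0$ for all $t,\omega$, then for every $\omega$ and $s$ the zero path on $[s,\infty)$ is the unique solution started at time $s$ in $0$. Hence $\{0\}$ is invariant, i.e. $S(t,s;\omega)\{0\}=\{0\}$ for all $\omega$ and $s\le t$, and $\mathcal A(\omega):=\{0\}$ is a forward attractor for $\varphi$: it is a compact random set, almost surely invariant under $\varphi$, and almost surely, for every bounded $B\subseteq H$, the Hausdorff semi-distance from $\varphi(t,\omega)B$ to $\mathcal A(\theta_t\omega)$ tends to $0$ as $t\to\infty$. -/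

import Mathlib

open MeasureTheory ProbabilityTheory Set Filter Topology
open scoped ENNReal NNReal InnerProductSpace

/-- A metric dynamical system: a jointly measurable, measure preserving action `θ` of `ℝ` on a
probability space. -/
structure IsMetricDynamicalSystem {Ω : Type*} [MeasurableSpace Ω] (P : Measure Ω)
    (θ : ℝ → Ω → Ω) : Prop where
  measurable : Measurable (fun z : ℝ × Ω => θ z.1 z.2)
  zero : ∀ ω, θ 0 ω = ω
  add : ∀ s t ω, θ (t + s) ω = θ t (θ s ω)
  preserving : ∀ t, MeasurePreserving (θ t) P P

/-- `β` is a two-sided real Brownian motion on the metric dynamical system `(Ω, P, θ)`: it has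
continuous paths, starts at `0`, has independent centred Gaussian increments with variance the
length of the time interval, and `θ` acts on it as the Wiener shift. On the canonical space of
continuous paths `w` with `w 0 = 0` one has `β t w = w t` and `θ t w = w (t + ·) - w t`. -/
structure IsTwoSidedBrownianMotion {Ω : Type*} [MeasurableSpace Ω] (P : Measure Ω)
    (θ : ℝ → Ω → Ω) (β : ℝ → Ω → ℝ) : Prop where
  measurable : ∀ t, Measurable (β t)
  continuous_path : ∀ ω, Continuous (fun t => β t ω)
  zero : ∀ ω, β 0 ω = 0
  law_increment : ∀ s t, s ≤ t →
    HasLaw (fun ω => β t ω - β s ω) (gaussianReal 0 (t - s).toNNReal) P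
  indep_increments : HasIndepIncrements β P
  shift : ∀ s t ω, β t (θ s ω) = β (t + s) ω - β s ω

/-- `ι : V → H` is the embedding of a Gelfand triple `V ⊆ H ≡ H* ⊆ V*`: `V` is reflexive and is
continuously and densely embedded into `H`. -/
structure IsGelfandEmbedding {V H : Type*} [NormedAddCommGroup V] [NormedSpace ℝ V]
    [NormedAddCommGroup H] [InnerProductSpace ℝ H] (ι : V →L[ℝ] H) : Prop where
  reflexive : Function.Surjective (NormedSpace.inclusionInDoubleDual ℝ V)
  injective : Function.Injective ι
  denseRange : DenseRange ι

/-- The embedding `H ≡ H* ⊆ V*` of a Gelfand triple, `h ↦ ⟨h, ι ·⟩_H`. -/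
noncomputable def gelfandDual {V H : Type*} [NormedAddCommGroup V] [NormedSpace ℝ V]
    [NormedAddCommGroup H] [InnerProductSpace ℝ H] (ι : V →L[ℝ] H) (h : H) : StrongDual ℝ V :=
  (innerSL ℝ h).comp ι

/-- Hemicontinuity, monotonicity, coercivity and growth of a drift `A : ℝ × V × Ω → V*`, with exponent `α ∈ (1, 2)`,
pathwise right-continuous coefficients `C₁`, `C₂`, `c > 0` and pathwise locally integrable `f`. -/
structure IsSingularDrift {Ω V H : Type*} [NormedAddCommGroup V] [NormedSpace ℝ V]
    [NormedAddCommGroup H] [InnerProductSpace ℝ H] (ι : V →L[ℝ] H) (α : ℝ)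
    (C₁ C₂ c f : ℝ → Ω → ℝ) (A : ℝ → V → Ω → StrongDual ℝ V) : Prop where
  one_lt : 1 < α
  lt_two : α < 2
  right_continuous_C₁ : ∀ ω t, ContinuousWithinAt (fun r => C₁ r ω) (Ici t) t
  right_continuous_C₂ : ∀ ω t, ContinuousWithinAt (fun r => C₂ r ω) (Ici t) t
  right_continuous_c : ∀ ω t, ContinuousWithinAt (fun r => c r ω) (Ici t) t
  c_pos : ∀ t ω, 0 < c t ω
  locallyIntegrable_f : ∀ ω, LocallyIntegrable (fun r => f r ω) volume
  hemicontinuous : ∀ t ω (v v₁ v₂ : V), Continuous (fun r : ℝ => A t (v₁ + r • v₂) ω v)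
  monotone : ∀ t ω (v₁ v₂ : V),
    2 * (A t v₁ ω - A t v₂ ω) (v₁ - v₂) ≤ C₂ t ω * ‖ι (v₁ - v₂)‖ ^ 2
  coercive : ∀ t ω (v : V), 2 * A t v ω v ≤ C₁ t ω * ‖ι v‖ ^ 2 - c t ω * ‖v‖ ^ α + f t ω
  growth : ∀ t ω (v : V),
    ‖A t v ω‖ ^ (α / (α - 1)) ≤ C₁ t ω * ‖ι v‖ ^ 2 + C₂ t ω * ‖v‖ ^ α + f t ω

/-- `Z` is a variational solution on `[s, ∞)` of `Z t = x + ∫ r in s..t, F r (Z r)`, an equation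
in `V*`: `Z ∈ C([s, ∞); H) ∩ L^α_loc([s, ∞); V)`. Here `z` is the `V`-valued version of `Z`,
which is determined almost everywhere since the embedding `ι` is injective. -/
def IsVariationalSolution {V H : Type*} [NormedAddCommGroup V] [NormedSpace ℝ V]
    [NormedAddCommGroup H] [InnerProductSpace ℝ H] (ι : V →L[ℝ] H) (α : ℝ)
    (F : ℝ → V → StrongDual ℝ V) (s : ℝ) (x : H) (Z : ℝ → H) : Prop :=
  ContinuousOn Z (Ici s) ∧
  ∃ z : ℝ → V,
    (∀ᵐ r ∂volume.restrict (Ici s), ι (z r) = Z r) ∧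
    (∀ T, MemLp z (ENNReal.ofReal α) (volume.restrict (Icc s T))) ∧
    (∀ t, s ≤ t → IntervalIntegrable (fun r => F r (z r)) volume s t) ∧
    ∀ t, s ≤ t → gelfandDual ι (Z t) = gelfandDual ι x + ∫ r in s..t, F r (z r)

/-- The multiplier `e^{-μ β_t}`. -/
noncomputable def brownianMultiplier {Ω : Type*} (μ : ℝ) (β : ℝ → Ω → ℝ) (t : ℝ) (ω : Ω) : ℝ :=
  Real.exp (-μ * β t ω)

/-- The transformed drift `A_ω(r, v) = μ_r(ω) A(r, μ_r(ω)⁻¹ v; ω)` with `μ_r = e^{-μ β_r}`. -/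
noncomputable def transformedDrift {Ω V : Type*} [NormedAddCommGroup V] [NormedSpace ℝ V]
    (μ : ℝ) (β : ℝ → Ω → ℝ) (A : ℝ → V → Ω → StrongDual ℝ V) (ω : Ω) (r : ℝ) (v : V) :
    StrongDual ℝ V :=
  brownianMultiplier μ β r ω • A r ((brownianMultiplier μ β r ω)⁻¹ • v) ω

/-- `X` is the path at `ω` of a solution of `dX = A(t, X) dt + μ X ∘ dβ` started at time `s`
in `x`: `X_t = μ_t⁻¹ Z_t`, where `Z` is a variational solution of the transformed random equation
`dZ = A_ω(t, Z) dt` started at time `s` in `μ_s x`. -/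
def IsSolutionPath {Ω V H : Type*} [NormedAddCommGroup V] [NormedSpace ℝ V]
    [NormedAddCommGroup H] [InnerProductSpace ℝ H] (ι : V →L[ℝ] H) (α μ : ℝ) (β : ℝ → Ω → ℝ)
    (A : ℝ → V → Ω → StrongDual ℝ V) (ω : Ω) (s : ℝ) (x : H) (X : ℝ → H) : Prop :=
  ∃ Z : ℝ → H,
    IsVariationalSolution ι α (transformedDrift μ β A ω) s (brownianMultiplier μ β s ω • x) Z ∧
    ∀ t, s ≤ t → X t = (brownianMultiplier μ β t ω)⁻¹ • Z t

/-- `S` is the flow `S t s ω : H → H`, `s ≤ t`, of the equation `dX = A(t, X) dt + μ X ∘ dβ`. -/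
def IsSolutionFlow {Ω V H : Type*} [NormedAddCommGroup V] [NormedSpace ℝ V]
    [NormedAddCommGroup H] [InnerProductSpace ℝ H] (ι : V →L[ℝ] H) (α μ : ℝ) (β : ℝ → Ω → ℝ)
    (A : ℝ → V → Ω → StrongDual ℝ V) (S : ℝ → ℝ → Ω → H → H) : Prop :=
  ∀ ω s x, IsSolutionPath ι α μ β A ω s x (fun t => S t s ω x)

/-- `‖B‖ = sup_{b ∈ B} ‖b‖`, for a bounded set `B` (`0` for the empty set). -/
noncomputable def setNorm {H : Type*} [NormedAddCommGroup H] (B : Set H) : ℝ :=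
  sSup (norm '' B)

/-- `K` is a forward attractor (of bounded sets) for `φ t ω : H → H`, `t ≥ 0`, over `θ`:
a compact random set that is almost surely invariant under `φ` and attracts every bounded set
forward in time, with respect to the Hausdorff semi-distance. -/
def IsForwardAttractor {Ω H : Type*} [MeasurableSpace Ω] [NormedAddCommGroup H] (P : Measure Ω)
    (θ : ℝ → Ω → Ω) (φ : ℝ → Ω → H → H) (K : Ω → Set H) : Prop :=
  (∀ x, Measurable (fun ω => Metric.infEDist x (K ω))) ∧
  ∀ᵐ ω ∂P,
    (K ω).Nonempty ∧ IsCompact (K ω) ∧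
    (∀ t, 0 ≤ t → φ t ω '' K ω = K (θ t ω)) ∧
    ∀ B : Set H, Bornology.IsBounded B →
      Tendsto (fun t => ⨆ y ∈ φ t ω '' B, Metric.infEDist y (K (θ t ω))) atTop (𝓝 0)

/-!
Along a solution `Z` of the transformed equation, the dissipativity of the drift gives, formally,
`(‖Z‖ ^ 2)' = 2 ⟨Z', Z⟩ ≤ - 2 λ μ_t ^ (2 - p) ‖Z‖ ^ p` with `μ_t = exp (- μ β_t)`. As `p < 2`, this is
`(‖Z‖ ^ (2 - p))' ≤ - (2 - p) λ μ_t ^ (2 - p)` as long as `Z` is nonzero. Hence `Z` reaches `0` as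
soon as `(2 - p) λ ∫ μ_r ^ (2 - p) dr` over `[s, T]` exceeds `(μ_s ‖x‖) ^ (2 - p)`, and stays there
since `‖Z‖` is nonincreasing. Three points have to be justified.

* The energy inequality (`norm_sq_sub_le_integral_pairing_of_continuousOn`). Increments of `‖Z‖ ^ 2`
  over a step `h` are averaged over their starting time; continuity of translations in `L^p` allows
  `h → 0`.
* Its use requires the drift along the solution to be in `L^{α'}(V*)`. The growth condition yields
  this only on a right neighbourhood of each time, because `C₁` and `C₂` are merely right-continuous.
  The decay estimate is therefore local to the right of each time, and it is made global by a
  comparison theorem for right Dini derivatives of continuous functions (`eq_zero_of_local_decay`).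
* `∫ exp (a β_r) dr` over a half-line is almost surely infinite
  (`IsTwoSidedBrownianMotion.ae_not_integrableOn_exp`). On the invariant event that it is finite, the
  logarithm of this integral exhibits a strictly positive function as cohomologous to `a β₁`, whose
  ergodic averages `a β_n / n` vanish in mean; by stationarity such an event is null
  (`measure_eq_zero_of_cocycle_pos`).

If the drift vanishes at `0`, the zero path is a solution, and it is the only one from `0` because
norms of solutions do not increase; attraction follows from extinction in finite time.
-/

/-! ### The energy inequality in a Gelfand triple -/

/-- Translations act continuously on `L^q` and `L^p`, so that the duality pairing of two translated
functions depends continuously on both shifts. -/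
theorem continuous_setIntegral_translate_pairing {V : Type*} [NormedAddCommGroup V]
    [NormedSpace ℝ V] {p q : ℝ≥0∞} [Fact (1 ≤ p)] [Fact (1 ≤ q)] [Fact (p ≠ ∞)] [Fact (q ≠ ∞)]
    [q.HolderConjugate p] {F : ℝ → StrongDual ℝ V} {z : ℝ → V}
    (hF : MemLp F q volume) (hz : MemLp z p volume) (s : Set ℝ) :
    Continuous (fun k : ℝ × ℝ => ∫ r in s, F (k.1 + r) (z (k.2 + r))) := by
  have key : Continuous (fun k : ℝ × ℝ => ∫ r in s,
      (((ContinuousLinearMap.id ℝ (StrongDual ℝ V)).holderL volume q p 1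
        (DomAddAct.mk k.1 +ᵥ hF.toLp F)) (DomAddAct.mk k.2 +ᵥ hz.toLp z)) r) := by
    refine (continuous_setIntegral s).comp ?_
    have h1 : Continuous (fun k : ℝ × ℝ => DomAddAct.mk k.1 +ᵥ hF.toLp F) :=
      (DomAddAct.continuous_mk.comp continuous_fst).vadd continuous_const
    have h2 : Continuous (fun k : ℝ × ℝ => DomAddAct.mk k.2 +ᵥ hz.toLp z) :=
      (DomAddAct.continuous_mk.comp continuous_snd).vadd continuous_const
    exact (((ContinuousLinearMap.id ℝ (StrongDual ℝ V)).holderL volume q p 1).continuous.comp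
      h1).clm_apply h2
  refine key.congr fun k => ?_
  refine integral_congr_ae (ae_restrict_of_ae ?_)
  rw [DomAddAct.mk_vadd_toLp, DomAddAct.mk_vadd_toLp]
  simp only [ContinuousLinearMap.holderL_apply_apply]
  filter_upwards [ContinuousLinearMap.coeFn_holder (r := 1)
      (ContinuousLinearMap.id ℝ (StrongDual ℝ V)) (MemLp.toLp (fun x => F (k.1 +ᵥ x))
        (hF.comp_measurePreserving (measurePreserving_vadd k.1 volume)))
      (MemLp.toLp (fun x => z (k.2 +ᵥ x))
        (hz.comp_measurePreserving (measurePreserving_vadd k.2 volume))),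
    MemLp.coeFn_toLp (hF.comp_measurePreserving (measurePreserving_vadd k.1 volume)),
    MemLp.coeFn_toLp (hz.comp_measurePreserving (measurePreserving_vadd k.2 volume))]
    with r h0 h1 h2
  refine h0.trans ?_
  simp only [Function.comp_def, vadd_eq_add] at h1 h2 ⊢
  simp [h1, h2]

/-- The pairing `(r, u) ↦ F (u + r) (z (h + r))` is integrable on bounded rectangles. -/
theorem integrableOn_translate_pairing {V : Type*} [NormedAddCommGroup V]
    [NormedSpace ℝ V] {p q : ℝ≥0∞} [q.HolderConjugate p] {F : ℝ → StrongDual ℝ V} {z : ℝ → V}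
    (hFm : StronglyMeasurable F) (hzm : StronglyMeasurable z)
    (hF : MemLp F q volume) (hz : MemLp z p volume) (h : ℝ) (a b c d : ℝ) :
    IntegrableOn (Function.uncurry fun r u => F (u + r) (z (h + r)))
      (uIoc a b ×ˢ uIoc c d) := by
  have hm : StronglyMeasurable (Function.uncurry fun r u => F (u + r) (z (h + r))) :=
    isBoundedBilinearMap_apply.continuous.comp_stronglyMeasurable
      ((hFm.comp_measurable (measurable_snd.add measurable_fst)).prodMk
        (hzm.comp_measurable (measurable_const.add measurable_fst)))
  have hφ : Integrable ((Icc (min a b + min c d) (max a b + max c d)).indicator fun v => ‖F v‖) :=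
    IntegrableOn.integrable_indicator
      ((hF.locallyIntegrable (ENNReal.HolderConjugate.one_le q p)).integrableOn_isCompact
        isCompact_Icc).norm measurableSet_Icc
  have hψ : Integrable ((uIoc a b).indicator fun r => ‖z (h + r)‖) := by
    refine IntegrableOn.integrable_indicator ?_ measurableSet_uIoc
    have hz' : MemLp (fun r => z (h + r)) p volume :=
      hz.comp_measurePreserving (measurePreserving_add_left volume h)
    exact (((hz'.locallyIntegrable (ENNReal.HolderConjugate.one_le p q)).integrableOn_isCompact
      isCompact_uIcc).mono_set uIoc_subset_uIcc).norm
  -- the shear `(r, u) ↦ (r, r + u)` preserves Lebesgue measure and separates the two factors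
  have hG := (measurePreserving_prod_add (volume : Measure ℝ)
    (volume : Measure ℝ)).integrable_comp_of_integrable (hψ.mul_prod hφ)
  refine Integrable.mono' hG.integrableOn hm.aestronglyMeasurable ?_
  refine (ae_restrict_iff' (measurableSet_uIoc.prod measurableSet_uIoc)).2 (.of_forall ?_)
  rintro ⟨r, u⟩ ⟨hr, hu⟩
  have hru : r + u ∈ Icc (min a b + min c d) (max a b + max c d) :=
    ⟨add_le_add hr.1.le hu.1.le, add_le_add hr.2 hu.2⟩
  have hr' : r ∈ uIoc a b := hr
  simp only [Function.comp_def, indicator_of_mem hru, indicator_of_mem hr', Function.uncurry]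
  rw [add_comm u r, mul_comm]
  exact (F (r + u)).le_opNorm _

/-- The energy inequality for globally defined data. For small `h` one has
`‖Z (r + h)‖ ^ 2 - ‖Z r‖ ^ 2 ≤ 2 * ⟪Z (r + h) - Z r, Z (r + h)⟫`, and the right-hand side is the
pairing of `∫ F` over `[r, r + h]` with `z (r + h)`. Averaging over `r`, dividing by `h` and
exchanging the integrals leaves a mean of translated pairings, which converges as `h → 0`. -/
theorem norm_sq_sub_le_integral_pairing {V H : Type*} [NormedAddCommGroup V]
    [NormedSpace ℝ V] [CompleteSpace V] [NormedAddCommGroup H] [InnerProductSpace ℝ H]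
    (ι : V →L[ℝ] H)
    {p q : ℝ≥0∞} [Fact (1 ≤ p)] [Fact (1 ≤ q)] [Fact (p ≠ ∞)] [Fact (q ≠ ∞)]
    [q.HolderConjugate p] {F : ℝ → StrongDual ℝ V} {z : ℝ → V} {Z : ℝ → H} {a t b : ℝ}
    (hFm : StronglyMeasurable F) (hzm : StronglyMeasurable z)
    (hF : MemLp F q volume) (hz : MemLp z p volume) (hZ : Continuous Z)
    (hιz : ∀ᵐ r ∂volume.restrict (Icc a b), ι (z r) = Z r)
    (hint : ∀ r r', a ≤ r → r ≤ r' → r' ≤ b →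
      gelfandDual ι (Z r') - gelfandDual ι (Z r) = ∫ u in r..r', F u)
    (hat : a ≤ t) (htb : t < b) :
    ‖Z t‖ ^ 2 - ‖Z a‖ ^ 2 ≤ 2 * ∫ r in a..t, F r (z r) := by
  set Ψ : ℝ × ℝ → ℝ := fun k => ∫ r in Ioc a t, F (k.1 + r) (z (k.2 + r)) with hΨ
  have hΨc : Continuous Ψ := continuous_setIntegral_translate_pairing hF hz _
  have hΨ0 : Ψ (0, 0) = ∫ r in a..t, F r (z r) := by
    simp [hΨ, intervalIntegral.integral_of_le hat]
  rw [← hΨ0]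
  have hy : Continuous (fun r => ‖Z r‖ ^ 2) := by fun_prop
  have hFloc : LocallyIntegrable F volume := hF.locallyIntegrable Fact.out
  -- a single increment, tested with its right end point
  have hstep : ∀ h, 0 < h → t + h ≤ b → ∀ᵐ r ∂volume.restrict (Ioc a t),
      ‖Z (r + h)‖ ^ 2 - ‖Z r‖ ^ 2 ≤ 2 * ∫ u in (0 : ℝ)..h, F (u + r) (z (h + r)) := by
    intro h hh hhb
    have hshift : ∀ᵐ r ∂volume, h + r ∈ Icc a b → ι (z (h + r)) = Z (h + r) :=
      (measurePreserving_add_left volume h).quasiMeasurePreserving.ae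
        ((ae_restrict_iff' measurableSet_Icc).1 hιz)
    filter_upwards [ae_restrict_of_ae hshift, ae_restrict_mem measurableSet_Ioc] with r hr hrt
    have hr' := hr ⟨by linarith [hrt.1], by linarith [hrt.2]⟩
    have hFi : IntervalIntegrable F volume r (r + h) :=
      (hFloc.integrableOn_isCompact isCompact_uIcc).intervalIntegrable
    have e1 : ∫ u in (0 : ℝ)..h, F (u + r) (z (h + r)) =
        (∫ u in r..r + h, F u) (z (h + r)) := by
      rw [ContinuousLinearMap.intervalIntegral_apply hFi]
      rw [intervalIntegral.integral_comp_add_right (fun u => F u (z (h + r)))]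
      simp [add_comm]
    rw [e1, ← hint r (r + h) hrt.1.le (by linarith) (by linarith [hrt.2])]
    have := norm_sub_sq_real (Z (r + h)) (Z r)
    rw [real_inner_comm] at this
    rw [add_comm h r] at hr' ⊢
    simp only [gelfandDual, sub_apply, ContinuousLinearMap.comp_apply,
      innerSL_apply_apply, hr', real_inner_self_eq_norm_sq]
    nlinarith [sq_nonneg ‖Z (r + h) - Z r‖]
  -- the averaged increments over `[a, t]` telescope to boundary averages at `t` and `a`
  have hL : Tendsto (fun h : ℝ => h⁻¹ * ∫ r in a..t, (‖Z (r + h)‖ ^ 2 - ‖Z r‖ ^ 2)) (𝓝[>] 0)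
      (𝓝 (‖Z t‖ ^ 2 - ‖Z a‖ ^ 2)) := by
    have hd : ∀ x, HasDerivAt (fun x => ∫ r in (0 : ℝ)..x, ‖Z r‖ ^ 2) (‖Z x‖ ^ 2) x := fun x =>
      intervalIntegral.integral_hasDerivAt_right (hy.intervalIntegrable _ _)
        (hy.stronglyMeasurableAtFilter _ _) hy.continuousAt
    refine ((hd t).tendsto_slope_zero_right.sub (hd a).tendsto_slope_zero_right).congr fun h => ?_
    have hi : ∀ x y, IntervalIntegrable (fun r => ‖Z r‖ ^ 2) volume x y := hy.intervalIntegrable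
    rw [intervalIntegral.integral_sub (Continuous.intervalIntegrable (by fun_prop) _ _) (hi _ _),
      intervalIntegral.integral_comp_add_right (fun r => ‖Z r‖ ^ 2), smul_eq_mul, smul_eq_mul,
      ← mul_sub, ← intervalIntegral.integral_interval_sub_left (hi 0 (t + h)) (hi 0 (a + h)),
      ← intervalIntegral.integral_interval_sub_left (hi 0 t) (hi 0 a)]
    ring
  refine le_of_forall_pos_le_add fun ε hε => ?_
  have hΨe : ∀ᶠ k in 𝓝 ((0 : ℝ), (0 : ℝ)), Ψ k < Ψ (0, 0) + ε / 2 :=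
    hΨc.continuousAt.eventually_lt_const (by linarith)
  obtain ⟨δ, hδ, hδΨ⟩ := Metric.eventually_nhds_iff.1 hΨe
  refine le_of_tendsto hL ?_
  have hev : ∀ᶠ h in 𝓝[>] (0 : ℝ), h < min δ (b - t) :=
    nhdsWithin_le_nhds (eventually_lt_nhds (lt_min hδ (by linarith)))
  filter_upwards [hev, self_mem_nhdsWithin] with h hlt (hh : 0 < h)
  have hδh : h < δ := hlt.trans_le (min_le_left _ _)
  have hbh : t + h ≤ b := by linarith [hlt.trans_le (min_le_right δ (b - t))]
  have hprod := integrableOn_translate_pairing hFm hzm hF hz h a t 0 h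
  have hbound : ∫ r in a..t, (‖Z (r + h)‖ ^ 2 - ‖Z r‖ ^ 2) ≤
      ∫ r in a..t, 2 * ∫ u in (0 : ℝ)..h, F (u + r) (z (h + r)) := by
    refine intervalIntegral.integral_mono_ae_restrict hat ?_ ?_ ?_
    · exact Continuous.intervalIntegrable (by fun_prop) _ _
    · refine ((intervalIntegrable_iff).2 ?_).const_mul 2
      rw [IntegrableOn, Measure.volume_eq_prod, ← Measure.prod_restrict] at hprod
      simp only [intervalIntegral.integral_of_le hh.le, ← uIoc_of_le hh.le]
      exact hprod.integral_prod_left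
    · rw [← restrict_Ioc_eq_restrict_Icc]
      exact hstep h hh hbh
  rw [intervalIntegral.integral_const_mul,
    intervalIntegral_intervalIntegral_swap hprod] at hbound
  have hΨbound : ∫ u in (0 : ℝ)..h, ∫ r in a..t, F (u + r) (z (h + r)) ≤
      ∫ u in (0 : ℝ)..h, (Ψ (0, 0) + ε / 2) := by
    simp only [intervalIntegral.integral_of_le hat]
    refine intervalIntegral.integral_mono_on hh.le ?_ (by simp) fun u hu => ?_
    · exact Continuous.intervalIntegrable (hΨc.comp (by fun_prop : Continuous fun u => (u, h))) _ _
    · refine (hδΨ (y := (u, h)) ?_).le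
      rw [Prod.dist_eq, Real.dist_0_eq_abs, Real.dist_0_eq_abs, abs_of_nonneg hu.1, abs_of_pos hh]
      exact max_lt (hu.2.trans_lt hδh) hδh
  rw [intervalIntegral.integral_const, sub_zero, smul_eq_mul] at hΨbound
  rw [inv_mul_le_iff₀ hh]
  nlinarith

/-- An `L^p` function on a measurable set is the restriction of an everywhere defined strongly
measurable function which is `L^p` on the whole space, namely its extension by zero. -/
theorem exists_stronglyMeasurable_memLp_extension {X E : Type*} [MeasurableSpace X]
    [NormedAddCommGroup E] {ν : Measure X} {s : Set X} (hs : MeasurableSet s) {p : ℝ≥0∞}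
    {g : X → E} (hg : MemLp g p (ν.restrict s)) :
    ∃ g', StronglyMeasurable g' ∧ MemLp g' p ν ∧ g =ᵐ[ν.restrict s] g' :=
  ⟨s.indicator (hg.1.mk g), hg.1.stronglyMeasurable_mk.indicator hs,
    (memLp_indicator_iff_restrict hs).2 ((memLp_congr_ae hg.1.ae_eq_mk).1 hg),
    hg.1.ae_eq_mk.trans (indicator_ae_eq_restrict hs).symm⟩

/-- Energy inequality of a Gelfand triple: if `Z` is continuous in `H`, lies in `L^p(a, b; V)` and
has weak derivative `F ∈ L^q(a, b; V*)` for conjugate exponents, then the increments of `‖Z‖ ^ 2`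
are controlled by the pairing of `F` and `Z`. -/
theorem norm_sq_sub_le_integral_pairing_of_continuousOn {V H : Type*} [NormedAddCommGroup V]
    [NormedSpace ℝ V] [CompleteSpace V] [NormedAddCommGroup H] [InnerProductSpace ℝ H]
    (ι : V →L[ℝ] H)
    {p q : ℝ≥0∞} [Fact (1 ≤ p)] [Fact (1 ≤ q)] [Fact (p ≠ ∞)] [Fact (q ≠ ∞)]
    [q.HolderConjugate p] {F : ℝ → StrongDual ℝ V} {z : ℝ → V} {Z : ℝ → H} {a t b : ℝ}
    (hF : MemLp F q (volume.restrict (Icc a b))) (hz : MemLp z p (volume.restrict (Icc a b)))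
    (hZ : Continuous Z) (hιz : ∀ᵐ r ∂volume.restrict (Icc a b), ι (z r) = Z r)
    (hint : ∀ r r', a ≤ r → r ≤ r' → r' ≤ b →
      gelfandDual ι (Z r') - gelfandDual ι (Z r) = ∫ u in r..r', F u)
    (hat : a ≤ t) (htb : t < b) :
    ‖Z t‖ ^ 2 - ‖Z a‖ ^ 2 ≤ 2 * ∫ r in a..t, F r (z r) := by
  obtain ⟨F', hFm, hF', eF⟩ := exists_stronglyMeasurable_memLp_extension measurableSet_Icc hF
  obtain ⟨z', hzm, hz', ez⟩ := exists_stronglyMeasurable_memLp_extension measurableSet_Icc hz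
  have hsub : ∀ {r r'}, a ≤ r → r' ≤ b → Ioc r r' ⊆ Icc a b := fun h h' u hu =>
    ⟨h.trans hu.1.le, hu.2.trans h'⟩
  have key := norm_sq_sub_le_integral_pairing ι (F := F') (z := z') (Z := Z) (a := a) (t := t)
    (b := b) (p := p) (q := q)
    hFm hzm hF' hz'
    hZ (by filter_upwards [hιz, ez] with r h1 h2; rw [← h2, h1])
    (fun r r' h1 h2 h3 => by
      rw [hint r r' h1 h2 h3]
      refine intervalIntegral.integral_congr_ae_restrict ?_
      rw [uIoc_of_le h2]
      exact ae_restrict_of_ae_restrict_of_subset (hsub h1 h3) eF) hat htb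
  refine key.trans_eq ?_
  congr 1
  refine intervalIntegral.integral_congr_ae_restrict ?_
  rw [uIoc_of_le hat]
  refine ae_restrict_of_ae_restrict_of_subset (hsub le_rfl htb.le) ?_
  filter_upwards [eF, ez] with r h1 h2
  rw [h1, h2]

/-! ### Divergence of the exponential functional of Brownian motion -/

/-- If a strictly positive function on an invariant set `G` is cohomologous to a function `b` whose
ergodic averages vanish in mean, then `G` is a null set: by invariance, the mean of the truncated
function equals the mean of its ergodic averages, which telescope. No integrability of the
transfer function `g` is needed. -/
theorem measure_eq_zero_of_cocycle_pos {Ω : Type*} [MeasurableSpace Ω] {P : Measure Ω}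
    [IsProbabilityMeasure P] {T : Ω → Ω} (hT : MeasurePreserving T P P) {G : Set Ω}
    (hG : MeasurableSet G) (hTG : ∀ ω, T ω ∈ G ↔ ω ∈ G) {g b : Ω → ℝ} (hg : Measurable g)
    (hb : Measurable b) (hpos : ∀ ω ∈ G, 0 < g ω - g (T ω) - b ω)
    (hint : ∀ n, Integrable (fun ω => ∑ k ∈ Finset.range n, b (T^[k] ω)) P)
    (hlim : Tendsto (fun n : ℕ => (∫ ω, |∑ k ∈ Finset.range n, b (T^[k] ω)| ∂P) / n)
      atTop (𝓝 0)) : P G = 0 := by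
  set d : Ω → ℝ := G.indicator fun ω => min 1 (g ω - g (T ω) - b ω) with hd
  have hdm : Measurable d :=
    (measurable_const.min ((hg.sub (hg.comp hT.measurable)).sub hb)).indicator hG
  have hd0 : ∀ ω, 0 ≤ d ω := fun ω =>
    indicator_nonneg (fun ω hω => le_min zero_le_one (hpos ω hω).le) ω
  have hd1 : ∀ ω, d ω ≤ 1 := fun ω =>
    indicator_le' (fun ω _ => min_le_left _ _) (fun _ _ => zero_le_one) ω
  have hbdd : ∀ {u : Ω → ℝ}, Measurable u → (∀ ω, 0 ≤ u ω) → (∀ ω, u ω ≤ 1) → Integrable u P :=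
    fun hu h0 h1 => Integrable.of_bound hu.aestronglyMeasurable 1
      (.of_forall fun ω => by rw [Real.norm_of_nonneg (h0 ω)]; exact h1 ω)
  have hTk : ∀ k, MeasurePreserving T^[k] P P := fun k => hT.iterate k
  have hdi : ∀ k : ℕ, Integrable (fun ω => d (T^[k] ω)) P := fun k =>
    hbdd (hdm.comp (hTk k).measurable) (fun ω => hd0 _) fun ω => hd1 _
  have hcomp : ∀ (k : ℕ) {u : Ω → ℝ}, Measurable u → ∫ ω, u (T^[k] ω) ∂P = ∫ ω, u ω ∂P := by
    intro k u hu
    rw [← (hTk k).map_eq, integral_map (hTk k).measurable.aemeasurable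
      hu.aestronglyMeasurable, (hTk k).map_eq]
  have hgm : ∀ n : ℕ, Measurable fun ω => min 1 (|g ω| / n) := fun n => by fun_prop
  have hgi : ∀ n : ℕ, Integrable (fun ω => min 1 (|g ω| / n)) P := fun n =>
    hbdd (hgm n) (fun ω => by positivity) fun ω => min_le_left _ _
  have hmem : ∀ ω ∈ G, ∀ k, T^[k] ω ∈ G := by
    intro ω hω k
    induction k with
    | zero => exact hω
    | succ k ih => rw [Function.iterate_succ_apply']; exact (hTG _).2 ih
  have hbound : ∀ n : ℕ, 0 < n → ∫ ω, d ω ∂P ≤ 2 * (∫ ω, min 1 (|g ω| / n) ∂P) +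
      (∫ ω, |∑ k ∈ Finset.range n, b (T^[k] ω)| ∂P) / n := by
    intro n hn
    have hn' : (0 : ℝ) < n := by exact_mod_cast hn
    have h1 : ∫ ω, d ω ∂P = ∫ ω, (∑ k ∈ Finset.range n, d (T^[k] ω)) / n ∂P := by
      rw [integral_div, integral_finsetSum _ fun k _ => hdi k]
      simp only [hcomp _ hdm, Finset.sum_const, Finset.card_range, nsmul_eq_mul]
      field_simp
    have hgi' : Integrable (fun ω => min 1 (|g (T^[n] ω)| / n)) P :=
      (hTk n).integrable_comp_of_integrable (hgi n)
    have hb' := (hint n).abs.div_const (n : ℝ)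
    have h2 : 2 * (∫ ω, min 1 (|g ω| / n) ∂P) +
        (∫ ω, |∑ k ∈ Finset.range n, b (T^[k] ω)| ∂P) / n =
        ∫ ω, (min 1 (|g ω| / n) + min 1 (|g (T^[n] ω)| / n) +
          |∑ k ∈ Finset.range n, b (T^[k] ω)| / n) ∂P := by
      rw [integral_add (f := fun ω => min 1 (|g ω| / n) + min 1 (|g (T^[n] ω)| / n))
        ((hgi n).add hgi') hb', integral_add (hgi n) hgi', integral_div, hcomp n (hgm n)]
      ring
    rw [h1, h2]
    refine integral_mono ?_ (((hgi n).add hgi').add hb') fun ω => ?_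
    · exact (integrable_finsetSum _ fun k _ => hdi k).div_const _
    by_cases hω : ω ∈ G
    · have hle1 : (∑ k ∈ Finset.range n, d (T^[k] ω)) / n ≤ 1 := by
        rw [div_le_one hn']
        calc _ ≤ ∑ k ∈ Finset.range n, (1 : ℝ) := Finset.sum_le_sum fun k _ => hd1 _
          _ = n := by simp
      have hle2 : ∑ k ∈ Finset.range n, d (T^[k] ω) ≤
          |g ω| + |g (T^[n] ω)| + |∑ k ∈ Finset.range n, b (T^[k] ω)| := by
        calc ∑ k ∈ Finset.range n, d (T^[k] ω)
            ≤ ∑ k ∈ Finset.range n, (g (T^[k] ω) - g (T^[k + 1] ω) - b (T^[k] ω)) := by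
              refine Finset.sum_le_sum fun k _ => ?_
              rw [hd, indicator_of_mem (hmem ω hω k), Function.iterate_succ_apply']
              exact min_le_right _ _
          _ = g ω - g (T^[n] ω) - ∑ k ∈ Finset.range n, b (T^[k] ω) := by
              rw [Finset.sum_sub_distrib, Finset.sum_range_sub' fun k => g (T^[k] ω)]
              rfl
          _ ≤ _ := by
              linarith [le_abs_self (g ω), neg_abs_le (g (T^[n] ω)),
                neg_abs_le (∑ k ∈ Finset.range n, b (T^[k] ω))]
      have hle3 : (∑ k ∈ Finset.range n, d (T^[k] ω)) / n ≤ |g ω| / n + |g (T^[n] ω)| / n +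
          |∑ k ∈ Finset.range n, b (T^[k] ω)| / n := by
        rw [← add_div, ← add_div]; gcongr
      have p1 : 0 ≤ |g ω| / n := by positivity
      have p2 : 0 ≤ |g (T^[n] ω)| / n := by positivity
      have p3 : 0 ≤ |∑ k ∈ Finset.range n, b (T^[k] ω)| / n := by positivity
      dsimp only
      rcases min_cases 1 (|g ω| / n) with h | h <;>
        rcases min_cases 1 (|g (T^[n] ω)| / n) with h' | h' <;> linarith [h.1, h'.1]
    · have hω' : ∀ k, T^[k] ω ∉ G := by
        intro k
        induction k with
        | zero => exact hω
        | succ k ih => rw [Function.iterate_succ_apply']; exact fun h => ih ((hTG _).1 h)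
      have : ∑ k ∈ Finset.range n, d (T^[k] ω) = 0 :=
        Finset.sum_eq_zero fun k _ => indicator_of_notMem (hω' k) _
      dsimp only
      rw [this, zero_div]
      positivity
  -- the truncation at `1` is what allows a transfer function `g` that is not integrable
  have hdct : Tendsto (fun n : ℕ => ∫ ω, min 1 (|g ω| / n) ∂P) atTop (𝓝 0) := by
    have := tendsto_integral_of_dominated_convergence (μ := P)
      (F := fun (n : ℕ) ω => min 1 (|g ω| / n)) (f := fun _ => 0) (fun _ => 1)
      (fun n => (hgm n).aestronglyMeasurable) (integrable_const _)
      (fun n => .of_forall fun ω => by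
        rw [Real.norm_of_nonneg (by positivity)]; exact min_le_left _ _)
      (.of_forall fun ω => by
        simpa using (tendsto_const_nhds (x := (1 : ℝ))).min
          (tendsto_const_div_atTop_nhds_zero_nat |g ω|))
    simpa using this
  have hle : ∫ ω, d ω ∂P ≤ 0 := by
    refine ge_of_tendsto ?_ ((eventually_gt_atTop 0).mono hbound)
    simpa using (hdct.const_mul 2).add hlim
  have hzero := (integral_eq_zero_iff_of_nonneg hd0 (hdi 0)).1
    (le_antisymm hle (integral_nonneg hd0))
  refine measure_mono_null (fun ω hω => ?_) (ae_iff.1 hzero)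
  have : 0 < d ω := by
    rw [hd, indicator_of_mem hω]
    exact lt_min one_pos (hpos ω hω)
  exact this.ne'

/-- First absolute moment of a Brownian motion, by Jensen's inequality. -/
theorem IsTwoSidedBrownianMotion.integrable_and_integral_abs_le {Ω : Type*} [MeasurableSpace Ω]
    {P : Measure Ω} {θ : ℝ → Ω → Ω} {β : ℝ → Ω → ℝ}
    [IsProbabilityMeasure P] (hβ : IsTwoSidedBrownianMotion P θ β) {t : ℝ} (ht : 0 ≤ t) :
    Integrable (β t) P ∧ ∫ ω, |β t ω| ∂P ≤ √t := by
  have hlaw : HasLaw (β t) (gaussianReal 0 t.toNNReal) P := by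
    simpa [hβ.zero] using hβ.law_increment 0 t ht
  have hL2 : MemLp (β t) 2 P := by
    have := memLp_id_gaussianReal (μ := 0) (v := t.toNNReal) 2
    rw [← hlaw.map_eq, memLp_map_measure_iff (by fun_prop) hlaw.aemeasurable] at this
    exact_mod_cast this
  have hL1 : MemLp (β t) 1 P := hL2.mono_exponent (by norm_num)
  have hmean : ∫ ω, β t ω ∂P = 0 := by rw [hlaw.integral_eq]; exact integral_id_gaussianReal
  have hvar : ∫ ω, β t ω ^ 2 ∂P = t := by
    have := hlaw.variance_eq
    rw [variance_id_gaussianReal, variance_of_integral_eq_zero hlaw.aemeasurable hmean] at this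
    rw [this, Real.coe_toNNReal t ht]
  refine ⟨memLp_one_iff_integrable.1 hL1, Real.le_sqrt_of_sq_le ?_⟩
  have := variance_nonneg |β t| P
  rw [variance_eq_sub hL2.abs] at this
  simp only [Pi.pow_apply, Pi.abs_apply, sq_abs, hvar] at this
  linarith

/-- The exponential functional of a Brownian motion over a half-line is almost surely infinite.
On the shift invariant event that `I = ∫ r in Ioi 0, exp (a * β r)` is finite,
`log I - log I ∘ θ₁ - a * β₁ = log (I / ∫ r in Ioi 1, exp (a * β r)) > 0`, whereas the ergodic sums
of `a * β₁` are `a * βₙ`, of order `√n` in mean. -/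
theorem IsTwoSidedBrownianMotion.ae_not_integrableOn_exp {Ω : Type*} [MeasurableSpace Ω]
    {P : Measure Ω} {θ : ℝ → Ω → Ω} {β : ℝ → Ω → ℝ} [IsProbabilityMeasure P]
    (hβ : IsTwoSidedBrownianMotion P θ β) (hθ : IsMetricDynamicalSystem P θ) (a : ℝ) :
    ∀ᵐ ω ∂P, ∀ s, ¬ IntegrableOn (fun r => Real.exp (a * β r ω)) (Ioi s) := by
  set e : ℝ → Ω → ℝ≥0∞ := fun r ω => ENNReal.ofReal (Real.exp (a * β r ω)) with he
  have hβc := hβ.continuous_path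
  have hcont : ∀ ω, Continuous fun r => Real.exp (a * β r ω) := fun ω => by
    have := hβc ω
    fun_prop
  have hem : Measurable (Function.uncurry e) :=
    ENNReal.measurable_ofReal.comp (measurable_uncurry_of_continuous_of_measurable hcont
      fun r => Real.measurable_exp.comp ((hβ.measurable r).const_mul a))
  set I : Ω → ℝ≥0∞ := fun ω => ∫⁻ r in Ioi 0, e r ω with hI
  have hIm : Measurable I := Measurable.lintegral_prod_left' hem
  have hfin : ∀ ω s t, ∫⁻ r in Ioc s t, e r ω < ∞ := fun ω s t =>
    ((hasFiniteIntegral_iff_ofReal (.of_forall fun r => (Real.exp_pos _).le)).1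
      ((hcont ω).integrableOn_Ioc (a := s) (b := t)).2)
  have hiff : ∀ ω s, IntegrableOn (fun r => Real.exp (a * β r ω)) (Ioi s) ↔
      ∫⁻ r in Ioi s, e r ω < ∞ := fun ω s => by
    rw [IntegrableOn, Integrable,
      hasFiniteIntegral_iff_ofReal (.of_forall fun r => (Real.exp_pos _).le)]
    exact and_iff_right (hcont ω).aestronglyMeasurable
  have hsplit : ∀ ω s t, s ≤ t →
      ∫⁻ r in Ioi s, e r ω = (∫⁻ r in Ioc s t, e r ω) + ∫⁻ r in Ioi t, e r ω := fun ω s t hst => by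
    rw [← Ioc_union_Ioi_eq_Ioi hst, lintegral_union measurableSet_Ioi]
    exact Set.disjoint_left.2 fun r hr hr' => (hr.2.trans_lt hr').false
  have htail : ∀ ω s t, s ≤ t → (∫⁻ r in Ioi s, e r ω < ∞ ↔ ∫⁻ r in Ioi t, e r ω < ∞) :=
    fun ω s t hst => by rw [hsplit ω s t hst, ENNReal.add_lt_top, and_iff_right (hfin ω s t)]
  have hshift : ∀ ω, I (θ 1 ω) =
      ENNReal.ofReal (Real.exp (-(a * β 1 ω))) * ∫⁻ r in Ioi 1, e r ω := by
    intro ω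
    have hm : Measurable fun r => e r ω := hem.comp measurable_prodMk_right
    rw [← lintegral_const_mul _ hm, ← (measurePreserving_add_right (volume : Measure ℝ)
      1).setLIntegral_comp_preimage measurableSet_Ioi (hm.const_mul _)]
    simp only [hI, he, preimage_add_const_Ioi, sub_self, hβ.shift,
      ← ENNReal.ofReal_mul (Real.exp_pos _).le, ← Real.exp_add]
    refine lintegral_congr fun r => ?_
    congr 2
    ring
  have hinv : ∀ ω, I (θ 1 ω) < ∞ ↔ I ω < ∞ := by
    intro ω
    rw [hshift]
    refine Iff.trans ⟨fun h => ?_, ENNReal.mul_lt_top ENNReal.ofReal_lt_top⟩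
      (htail ω 0 1 zero_le_one).symm
    exact ENNReal.lt_top_of_mul_ne_top_right h.ne
      (ENNReal.ofReal_pos.2 (Real.exp_pos _)).ne'
  have hiter : ∀ k : ℕ, ∀ ω, (θ 1)^[k] ω = θ k ω := by
    intro k ω
    induction k with
    | zero => simp [hθ.zero]
    | succ k ih => rw [Function.iterate_succ_apply', ih, ← hθ.add, Nat.cast_succ, add_comm]
  have hsum : ∀ (n : ℕ) ω, ∑ k ∈ Finset.range n, a * β 1 ((θ 1)^[k] ω) = a * β n ω := by
    intro n ω
    have := Finset.sum_range_sub (fun k : ℕ => β k ω) n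
    simp only [hiter, hβ.shift, ← Finset.mul_sum, add_comm (1 : ℝ), ← Nat.cast_succ] at this ⊢
    rw [this]
    simp [hβ.zero]
  have hmom := fun n : ℕ => hβ.integrable_and_integral_abs_le (Nat.cast_nonneg n)
  have hnull : P {ω | I ω < ∞} = 0 := by
    refine measure_eq_zero_of_cocycle_pos (hθ.preserving 1) (measurableSet_lt hIm measurable_const)
      hinv (g := fun ω => Real.log (I ω).toReal) (b := fun ω => a * β 1 ω)
      (Real.measurable_log.comp hIm.ennreal_toReal) ((hβ.measurable 1).const_mul a) ?_ ?_ ?_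
    · intro ω hω
      have hJ : ∫⁻ r in Ioi 1, e r ω < ∞ := (htail ω 0 1 zero_le_one).1 hω
      have hpos : ∀ s t, s < t → 0 < ∫⁻ r in Ioc s t, e r ω := fun s t hst => by
        refine (setLIntegral_pos_iff (hem.comp measurable_prodMk_right)).2 ?_
        have hsupp : Function.support (fun r => e r ω) = univ :=
          eq_univ_of_forall fun r => (ENNReal.ofReal_pos.2 (Real.exp_pos _)).ne'
        simpa [Function.comp_def, hsupp] using hst
      have hJ0 : 0 < ∫⁻ r in Ioi 1, e r ω :=
        (hpos 1 2 (by norm_num)).trans_le (lintegral_mono_set Ioc_subset_Ioi_self)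
      rw [hshift, ENNReal.toReal_mul, ENNReal.toReal_ofReal (Real.exp_pos _).le,
        Real.log_mul (Real.exp_pos _).ne' (ENNReal.toReal_pos hJ0.ne' hJ.ne).ne', Real.log_exp]
      have : Real.log (∫⁻ r in Ioi 1, e r ω).toReal < Real.log (I ω).toReal := by
        refine Real.log_lt_log (ENNReal.toReal_pos hJ0.ne' hJ.ne) ?_
        refine ENNReal.toReal_strict_mono (ne_of_lt hω) ?_
        change _ < ∫⁻ r in Ioi 0, e r ω
        rw [hsplit ω 0 1 zero_le_one, add_comm]
        exact ENNReal.lt_add_right hJ.ne (hpos 0 1 one_pos).ne'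
      linarith
    · intro n
      simp only [hsum]
      exact (hmom n).1.const_mul a
    · simp only [hsum, abs_mul, integral_const_mul]
      have hz : Tendsto (fun n : ℕ => |a| / √(n : ℝ)) atTop (𝓝 0) :=
        tendsto_const_nhds.div_atTop (Real.tendsto_sqrt_atTop.comp tendsto_natCast_atTop_atTop)
      refine squeeze_zero (fun n => by positivity) (fun n => ?_) hz
      calc |a| * (∫ ω, |β n ω| ∂P) / n ≤ |a| * √n / n := by gcongr; exact (hmom n).2
        _ = |a| / √(n : ℝ) := by rw [mul_div_assoc, Real.sqrt_div_self', mul_one_div]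
  filter_upwards [measure_eq_zero_iff_ae_notMem.1 hnull] with ω hω s
  rw [hiff]
  rcases le_total s 0 with hs | hs
  · rwa [htail ω s 0 hs]
  · rwa [← htail ω 0 s hs]

/-! ### Extinction for scalar differential inequalities -/

/-- A continuous function which is locally nonincreasing to the right of every time is
nonincreasing; nothing is assumed to the left. -/
theorem antitoneOn_of_eventually_le_right {y : ℝ → ℝ} {s : ℝ} (hy : Continuous y)
    (hloc : ∀ t, s ≤ t → ∀ᶠ r in 𝓝[>] t, y r ≤ y t) : AntitoneOn y (Ici s) := by
  intro a ha b _ hab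
  refine image_le_of_liminf_slope_right_le_deriv_boundary (B := fun _ => y a) (B' := fun _ => 0)
    hy.continuousOn le_rfl continuousOn_const (fun x _ => hasDerivWithinAt_const _ _ _)
    (fun x hx r hr => ?_) (right_mem_Icc.2 hab)
  refine Eventually.frequently ?_
  filter_upwards [hloc x (le_trans ha hx.1), self_mem_nhdsWithin] with u hu (hxu : x < u)
  refine lt_of_le_of_lt ?_ hr
  rw [slope_def_field]
  exact div_nonpos_of_nonpos_of_nonneg (sub_nonpos.2 hu) (sub_nonneg.2 hxu.le)

/-- Extinction: `(N ^ 2)' ≤ - k N ^ p` with `p < 2` forces `N ^ (2 - p)` to decrease at rate at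
least `(2 - p) / 2 * k`, as long as `N` is positive. The differential inequality is only assumed
on a right neighbourhood of every time, in integrated form. -/
theorem eq_zero_of_local_decay {N k : ℝ → ℝ} {p s T : ℝ} (hp2 : p < 2)
    (hN : Continuous N) (hN0 : ∀ t, 0 ≤ N t) (hk : Continuous k) (hp0 : 0 < p)
    (hanti : AntitoneOn N (Ici s))
    (hloc : ∀ t, s ≤ t → ∀ᶠ r in 𝓝[>] t, N r ^ 2 ≤ N t ^ 2 - ∫ u in t..r, k u * N u ^ p)
    (hsT : s ≤ T) (hT : N s ^ (2 - p) ≤ (2 - p) / 2 * ∫ u in s..T, k u) : N T = 0 := by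
  by_contra hne
  have hpos : ∀ t ∈ Icc s T, 0 < N t := fun t ht =>
    ((hN0 T).lt_of_ne' hne).trans_le (hanti ht.1 hsT ht.2)
  have hderivk : ∀ x, HasDerivAt (fun x => ∫ u in s..x, k u) (k x) x := fun x =>
    intervalIntegral.integral_hasDerivAt_right (hk.intervalIntegrable _ _)
      (hk.stronglyMeasurableAtFilter _ _) hk.continuousAt
  have hcmp := image_le_of_liminf_slope_right_le_deriv_boundary (a := s) (b := T)
    (f := fun t => N t ^ (2 - p))
    (B := fun t => N s ^ (2 - p) - (2 - p) / 2 * ∫ u in s..t, k u)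
    (B' := fun t => - ((2 - p) / 2 * k t))
    (hN.rpow_const fun t => Or.inr (by linarith)).continuousOn (by simp)
    (fun x _ => (((hderivk x).const_mul _).const_sub _).continuousAt.continuousWithinAt)
    (fun x _ => (((hderivk x).const_mul _).const_sub _).hasDerivWithinAt)
    (fun x hx r hr => ?_) (right_mem_Icc.2 hsT)
  · have h1 : 0 < N T ^ (2 - p) := Real.rpow_pos_of_pos (hpos T (right_mem_Icc.2 hsT)) _
    linarith
  · have hx0 : 0 < N x := hpos x ⟨hx.1, hx.2.le⟩
    -- `G` is a differentiable function that touches `N ^ (2 - p)` from above at `x`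
    set G : ℝ → ℝ := fun t => (N x ^ 2 - ∫ u in x..t, k u * N u ^ p) ^ ((2 - p) / 2) with hG
    have hkN : Continuous fun u => k u * N u ^ p := by
      have := hN.rpow_const (p := p) fun t => Or.inr hp0.le
      fun_prop
    have hGd : HasDerivAt G (-((2 - p) / 2 * k x)) x := by
      have h0 : HasDerivAt (fun t => N x ^ 2 - ∫ u in x..t, k u * N u ^ p)
          (-(k x * N x ^ p)) x :=
        (intervalIntegral.integral_hasDerivAt_right (hkN.intervalIntegrable _ _)
          (hkN.stronglyMeasurableAtFilter _ _) hkN.continuousAt).const_sub _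
      have h1 := h0.rpow_const (p := (2 - p) / 2) (Or.inl (by simp [hx0.ne']))
      convert h1 using 1
      have h2 : (N x ^ 2) ^ ((2 - p) / 2 - 1) = (N x ^ p)⁻¹ := by
        rw [← Real.rpow_natCast, ← Real.rpow_mul hx0.le, ← Real.rpow_neg hx0.le]
        congr 1
        push_cast
        ring
      have h3 : N x ^ p ≠ 0 := (Real.rpow_pos_of_pos hx0 _).ne'
      simp only [intervalIntegral.integral_same, sub_zero, h2]
      field_simp
    have hslope : ∀ᶠ u in 𝓝[>] x, slope G x u < r :=
      ((hasDerivAt_iff_tendsto_slope.1 hGd).mono_left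
        (nhdsWithin_mono _ fun u hu => (ne_of_gt hu : u ≠ x))).eventually_lt_const hr
    refine Eventually.frequently ?_
    filter_upwards [hslope, hloc x hx.1, self_mem_nhdsWithin] with u hu hNu (hxu : x < u)
    refine lt_of_le_of_lt ?_ hu
    have hsq : ∀ t, N t ^ (2 - p) = (N t ^ 2) ^ ((2 - p) / 2) := fun t => by
      rw [← Real.rpow_natCast, ← Real.rpow_mul (hN0 t)]
      congr 1
      push_cast
      ring
    rw [slope_def_field, slope_def_field]
    refine div_le_div_of_nonneg_right ?_ (sub_nonneg.2 hxu.le)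
    refine sub_le_sub ?_ ?_
    · rw [hsq]
      exact Real.rpow_le_rpow (sq_nonneg _) hNu (by linarith)
    · simp only [hG, intervalIntegral.integral_same, sub_zero, hsq, le_refl]

theorem exists_le_intervalIntegral_of_not_integrableOn {k : ℝ → ℝ} (hk : Continuous k)
    (hk0 : ∀ r, 0 ≤ k r) {s : ℝ} (hs : ¬ IntegrableOn k (Ioi s)) (C : ℝ) :
    ∃ T, s ≤ T ∧ C ≤ ∫ r in s..T, k r := by
  by_contra! h
  refine hs (integrableOn_Ioi_of_intervalIntegral_norm_bounded C s
    (fun T => hk.integrableOn_Ioc) tendsto_id ?_)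
  filter_upwards [eventually_ge_atTop s] with T hT
  simpa [abs_of_nonneg (hk0 _)] using (h T hT).le

/-! ### Energy decay of variational solutions -/

theorem gelfandDual_injective {V H : Type*} [NormedAddCommGroup V] [NormedSpace ℝ V]
    [NormedAddCommGroup H] [InnerProductSpace ℝ H] {ι : V →L[ℝ] H} (hι : DenseRange ι) :
    Function.Injective (gelfandDual ι) := by
  intro x y hxy
  refine ext_inner_right ℝ fun w => ?_
  have hx : Continuous fun w : H => ⟪x, w⟫_ℝ := by fun_prop
  have hy : Continuous fun w : H => ⟪y, w⟫_ℝ := by fun_prop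
  refine congr_fun (hι.equalizer hx hy (funext fun v => ?_)) w
  exact DFunLike.congr_fun hxy v

/-- Along a continuous curve of `H`, on a short interval to the right of any time, the growth
condition places the transformed drift in `L^{α'}(V*)`, `α' = α / (α - 1)`. Right continuity bounds
`C₁` and `C₂` on such intervals only, since they may be unbounded near a time from the left. -/
theorem IsSingularDrift.eventually_memLp_transformedDrift {Ω V H : Type*} [NormedAddCommGroup V]
    [NormedSpace ℝ V] [NormedAddCommGroup H] [InnerProductSpace ℝ H] {ι : V →L[ℝ] H} {α : ℝ}
    {C₁ C₂ c f : ℝ → Ω → ℝ} {A : ℝ → V → Ω → StrongDual ℝ V}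
    (hA : IsSingularDrift ι α C₁ C₂ c f A) {β : ℝ → Ω → ℝ} {μ : ℝ} {ω : Ω}
    (hβ : Continuous fun t => β t ω) {t : ℝ} {z : ℝ → V} {Z : ℝ → H} (hZ : Continuous Z)
    (hιz : ∀ᵐ r ∂volume.restrict (Ici t), ι (z r) = Z r)
    (hz : ∀ T, MemLp z (ENNReal.ofReal α) (volume.restrict (Icc t T)))
    (hF : ∀ T, AEStronglyMeasurable (fun r => transformedDrift μ β A ω r (z r))
      (volume.restrict (Icc t T))) :
    ∀ᶠ b in 𝓝[>] t, MemLp (fun r => transformedDrift μ β A ω r (z r))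
      (ENNReal.ofReal (α / (α - 1))) (volume.restrict (Icc t b)) := by
  have hα0 : 0 < α := one_pos.trans hA.one_lt
  have hq0 : 0 < α / (α - 1) := div_pos hα0 (sub_pos.2 hA.one_lt)
  have hC : ∀ᶠ r in 𝓝[≥] t, C₁ r ω < |C₁ t ω| + 1 ∧ C₂ r ω < |C₂ t ω| + 1 :=
    ((hA.right_continuous_C₁ ω t).eventually_lt_const
      (by linarith [le_abs_self (C₁ t ω)])).and
    ((hA.right_continuous_C₂ ω t).eventually_lt_const (by linarith [le_abs_self (C₂ t ω)]))
  obtain ⟨b₀, hb₀, hC⟩ := (mem_nhdsGE_iff_exists_Icc_subset).1 hC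
  filter_upwards [Ioc_mem_nhdsGT hb₀] with b hb
  set m : ℝ → ℝ := fun r => brownianMultiplier μ β r ω with hm
  have hmc : Continuous m := Real.continuous_exp.comp (hβ.const_mul (-μ))
  have hm0 : ∀ r, 0 < m r := fun r => Real.exp_pos _
  have hmq : ∀ x : ℝ, Continuous fun r => m r ^ x := fun x =>
    hmc.rpow_const fun r => Or.inl (hm0 r).ne'
  have hqne : ENNReal.ofReal (α / (α - 1)) ≠ 0 := (ENNReal.ofReal_pos.2 hq0).ne'
  rw [← integrable_norm_rpow_iff (hF b) hqne ENNReal.ofReal_ne_top,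
    ENNReal.toReal_ofReal hq0.le]
  have hz1 : IntegrableOn (fun r => ‖z r‖ ^ α) (Icc t b) := by
    have := (hz b).integrable_norm_rpow (ENNReal.ofReal_pos.2 hα0).ne' ENNReal.ofReal_ne_top
    rwa [ENNReal.toReal_ofReal hα0.le] at this
  have hf1 : IntegrableOn (fun r => f r ω) (Icc t b) :=
    (hA.locallyIntegrable_f ω).integrableOn_isCompact isCompact_Icc
  have hdom : IntegrableOn (fun r => m r ^ (α / (α - 1)) * ((|C₁ t ω| + 1) * ‖(m r)⁻¹ • Z r‖ ^ 2 +
      ((|C₂ t ω| + 1) * m r ^ (-α)) * ‖z r‖ ^ α + f r ω)) (Icc t b) := by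
    refine IntegrableOn.continuousOn_mul (hmq _).continuousOn ?_ isCompact_Icc
    refine ((Continuous.continuousOn ?_).integrableOn_Icc.add ?_).add hf1
    · have hmi : Continuous fun r => (m r)⁻¹ := hmc.inv₀ fun r => (hm0 r).ne'
      exact ((hmi.smul hZ).norm.pow 2).const_mul _
    · exact IntegrableOn.continuousOn_mul ((hmq _).const_mul _).continuousOn hz1 isCompact_Icc
  refine hdom.mono' ((hF b).norm.aemeasurable.pow_const _).aestronglyMeasurable ?_
  filter_upwards [ae_restrict_of_ae_restrict_of_subset Icc_subset_Ici_self hιz,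
    ae_restrict_mem measurableSet_Icc] with r hr hrt
  have hg := hA.growth r ω ((m r)⁻¹ • z r)
  obtain ⟨h1, h2⟩ := hC ⟨hrt.1, hrt.2.trans hb.2⟩
  rw [Real.norm_of_nonneg (by positivity), transformedDrift, norm_smul,
    Real.norm_of_nonneg (hm0 r).le, Real.mul_rpow (hm0 r).le (norm_nonneg _)]
  refine mul_le_mul_of_nonneg_left (hg.trans ?_) (Real.rpow_nonneg (hm0 r).le _)
  have e : ‖(m r)⁻¹ • z r‖ ^ α = m r ^ (-α) * ‖z r‖ ^ α := by
    rw [norm_smul, Real.norm_of_nonneg (inv_nonneg.2 (hm0 r).le),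
      Real.mul_rpow (inv_nonneg.2 (hm0 r).le) (norm_nonneg _), Real.inv_rpow (hm0 r).le,
      Real.rpow_neg (hm0 r).le]
  rw [map_smul, hr, e, mul_assoc]
  have h3 : 0 ≤ m r ^ (-α) * ‖z r‖ ^ α :=
    mul_nonneg (Real.rpow_nonneg (hm0 r).le _) (Real.rpow_nonneg (norm_nonneg _) _)
  gcongr

/-- Energy decay of a solution of the transformed equation, on a right neighbourhood of every time.
The curve `u ↦ Z (max s u)` extends `Z` continuously to times before `s`. -/
theorem IsVariationalSolution.eventually_norm_sq_le {Ω V H : Type*} [NormedAddCommGroup V]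
    [NormedSpace ℝ V] [CompleteSpace V] [NormedAddCommGroup H] [InnerProductSpace ℝ H]
    {ι : V →L[ℝ] H} {α : ℝ}
    {C₁ C₂ c f : ℝ → Ω → ℝ} {A : ℝ → V → Ω → StrongDual ℝ V}
    (hA : IsSingularDrift ι α C₁ C₂ c f A) {β : ℝ → Ω → ℝ} {μ : ℝ} {ω : Ω}
    (hβ : Continuous fun t => β t ω) {l p : ℝ} (hp0 : 0 < p)
    (hstrict : ∀ t v, A t v ω v ≤ -l * ‖ι v‖ ^ p) {s : ℝ} {x : H} {Z : ℝ → H}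
    (hZ : IsVariationalSolution ι α (transformedDrift μ β A ω) s x Z) {t : ℝ} (hst : s ≤ t) :
    ∀ᶠ r in 𝓝[>] t, ‖Z r‖ ^ 2 ≤ ‖Z t‖ ^ 2 -
      ∫ u in t..r, 2 * l * Real.exp (-(μ * (2 - p)) * β u ω) * ‖Z (max s u)‖ ^ p := by
  obtain ⟨hZc, z, hιz, hz, hFi, hZint⟩ := hZ
  set F : ℝ → StrongDual ℝ V := fun r => transformedDrift μ β A ω r (z r) with hFdef
  set Z' : ℝ → H := fun r => Z (max s r) with hZ'
  have hZ'c : Continuous Z' :=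
    hZc.comp_continuous (by fun_prop) fun r => mem_Ici.2 (le_max_left _ _)
  have hZe : ∀ r, s ≤ r → Z' r = Z r := fun r hr => by simp [hZ', hr]
  have hιz' : ∀ᵐ r ∂volume.restrict (Ici t), ι (z r) = Z' r := by
    filter_upwards [ae_restrict_of_ae_restrict_of_subset (Ici_subset_Ici.2 hst) hιz,
      ae_restrict_mem measurableSet_Ici] with r h1 h2
    rw [h1, hZe r (hst.trans h2)]
  have hz' : ∀ T, MemLp z (ENNReal.ofReal α) (volume.restrict (Icc t T)) := fun T =>
    (hz T).mono_measure (Measure.restrict_mono (Icc_subset_Icc_left hst) le_rfl)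
  have hFm : ∀ T, AEStronglyMeasurable F (volume.restrict (Icc t T)) := fun T => by
    rcases le_total t T with h | h
    · have := (hFi T (hst.trans h)).aestronglyMeasurable
      rw [restrict_Ioc_eq_restrict_Icc] at this
      exact this.mono_measure (Measure.restrict_mono (Icc_subset_Icc_left hst) le_rfl)
    · rw [← restrict_Ioc_eq_restrict_Icc, Ioc_eq_empty (not_lt.2 h)]
      simp
  obtain ⟨b, hbF, htb⟩ := ((hA.eventually_memLp_transformedDrift hβ hZ'c hιz' hz' hFm).and
    self_mem_nhdsWithin).exists
  have hconj : (α / (α - 1)).HolderConjugate α :=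
    (Real.HolderConjugate.conjExponent hA.one_lt).symm
  have : (ENNReal.ofReal (α / (α - 1))).HolderConjugate (ENNReal.ofReal α) := hconj.ennrealOfReal
  have : Fact (1 ≤ ENNReal.ofReal α) := ⟨by simpa using hA.one_lt.le⟩
  have : Fact (1 ≤ ENNReal.ofReal (α / (α - 1))) := ⟨by simpa using hconj.lt.le⟩
  have : Fact (ENNReal.ofReal α ≠ ∞) := ⟨ENNReal.ofReal_ne_top⟩
  have : Fact (ENNReal.ofReal (α / (α - 1)) ≠ ∞) := ⟨ENNReal.ofReal_ne_top⟩
  filter_upwards [Ioo_mem_nhdsGT htb] with r hr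
  have henergy := norm_sq_sub_le_integral_pairing_of_continuousOn ι hbF (hz' b) hZ'c
    (ae_restrict_of_ae_restrict_of_subset Icc_subset_Ici_self hιz') (fun u u' h1 h2 h3 => by
      have hu := hst.trans h1
      have hu' := hu.trans h2
      rw [hZe u hu, hZe u' hu', hZint u hu, hZint u' hu', add_sub_add_left_eq_sub,
        intervalIntegral.integral_interval_sub_left (hFi u' hu') (hFi u hu)]) hr.1.le hr.2
  rw [hZe t hst, hZe r (hst.trans hr.1.le), ← intervalIntegral.integral_const_mul] at henergy
  have hpair : IntegrableOn (fun u => F u (z u)) (Icc t b) :=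
    memLp_one_iff_integrable.1
      ((ContinuousLinearMap.id ℝ (StrongDual ℝ V)).memLp_of_bilin 1 hbF (hz' b))
  have hmono : ∫ u in t..r, 2 * F u (z u) ≤
      ∫ u in t..r, -(2 * l * Real.exp (-(μ * (2 - p)) * β u ω) * ‖Z' u‖ ^ p) := by
    refine intervalIntegral.integral_mono_ae_restrict hr.1.le ?_ ?_ ?_
    · exact ((intervalIntegrable_iff_integrableOn_Icc_of_le hr.1.le).2
        (hpair.mono_set (Icc_subset_Icc_right hr.2.le))).const_mul 2
    · have := hZ'c.norm.rpow_const (p := p) fun _ => Or.inr hp0.le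
      exact Continuous.intervalIntegrable (by fun_prop) _ _
    · filter_upwards [ae_restrict_of_ae_restrict_of_subset Icc_subset_Ici_self hιz'] with u hu
      set m := brownianMultiplier μ β u ω with hm
      have hm0 : 0 < m := Real.exp_pos _
      have h1 := hstrict u (m⁻¹ • z u)
      have h2 : F u (z u) = m ^ 2 * A u (m⁻¹ • z u) ω (m⁻¹ • z u) := by
        simp only [hFdef, transformedDrift, ← hm, smul_apply, smul_eq_mul, map_smul]
        field_simp
      have h3 : m ^ 2 * ‖ι (m⁻¹ • z u)‖ ^ p =
          Real.exp (-(μ * (2 - p)) * β u ω) * ‖Z' u‖ ^ p := by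
        rw [map_smul, hu, norm_smul, Real.norm_of_nonneg (inv_nonneg.2 hm0.le),
          Real.mul_rpow (inv_nonneg.2 hm0.le) (norm_nonneg _), ← mul_assoc, hm,
          brownianMultiplier, ← Real.exp_neg, ← Real.exp_mul, ← Real.exp_nat_mul, ← Real.exp_add]
        congr 2
        push_cast
        ring
      have h4 := mul_le_mul_of_nonneg_left h1 (sq_nonneg m)
      rw [h2, mul_assoc (2 * l), ← h3]
      linarith
  rw [intervalIntegral.integral_neg] at hmono
  linarith

theorem IsVariationalSolution.initial_value {V H : Type*} [NormedAddCommGroup V]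
    [NormedSpace ℝ V] [NormedAddCommGroup H] [InnerProductSpace ℝ H] {ι : V →L[ℝ] H} {α s : ℝ}
    {x : H} {Z : ℝ → H} (hι : DenseRange ι) {F : ℝ → V → StrongDual ℝ V}
    (hZ : IsVariationalSolution ι α F s x Z) : Z s = x := by
  obtain ⟨-, z, -, -, -, hint⟩ := hZ
  exact gelfandDual_injective hι (by simpa using hint s le_rfl)

/-! ### Extinction of solution paths -/

section Paths

variable {Ω V H : Type*} [NormedAddCommGroup V] [NormedSpace ℝ V] [CompleteSpace V]
  [NormedAddCommGroup H] [InnerProductSpace ℝ H] {ι : V →L[ℝ] H} {α : ℝ}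
  {C₁ C₂ c f : ℝ → Ω → ℝ} {A : ℝ → V → Ω → StrongDual ℝ V}
  {β : ℝ → Ω → ℝ} {μ : ℝ} {ω : Ω} {l p s : ℝ} {x : H} {Z X : ℝ → H}

theorem IsVariationalSolution.antitoneOn_norm (hA : IsSingularDrift ι α C₁ C₂ c f A)
    (hβ : Continuous fun t => β t ω) (hl : 0 < l) (hp0 : 0 < p)
    (hstrict : ∀ t v, A t v ω v ≤ -l * ‖ι v‖ ^ p)
    (hZ : IsVariationalSolution ι α (transformedDrift μ β A ω) s x Z) :
    AntitoneOn (fun t => ‖Z (max s t)‖) (Ici s) := by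
  have hc : Continuous fun t => ‖Z (max s t)‖ :=
    (hZ.1.comp_continuous (by fun_prop) fun r => mem_Ici.2 (le_max_left _ _)).norm
  refine antitoneOn_of_eventually_le_right hc fun t ht => ?_
  filter_upwards [hZ.eventually_norm_sq_le hA hβ hp0 hstrict ht, self_mem_nhdsWithin]
    with r hr (htr : t < r)
  rw [max_eq_right ht, max_eq_right (ht.trans htr.le)]
  refine (sq_le_sq₀ (norm_nonneg _) (norm_nonneg _)).1 (hr.trans (sub_le_self _ ?_))
  exact intervalIntegral.integral_nonneg htr.le fun u _ => by positivity

/-- A solution started at time `s` in `x` vanishes once the exponential functional of the Brownian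
motion has exceeded a level that depends on `‖x‖`, `s` and `ω` only. -/
theorem IsSolutionPath.eq_zero_of_le (hA : IsSingularDrift ι α C₁ C₂ c f A) (hι : DenseRange ι)
    (hβ : Continuous fun t => β t ω) (hl : 0 < l) (hp0 : 0 < p) (hp2 : p < 2)
    (hstrict : ∀ t v, A t v ω v ≤ -l * ‖ι v‖ ^ p) (hX : IsSolutionPath ι α μ β A ω s x X)
    {T t : ℝ} (hsT : s ≤ T) (hTt : T ≤ t)
    (hT : (brownianMultiplier μ β s ω * ‖x‖) ^ (2 - p) ≤
      (2 - p) * l * ∫ u in s..T, Real.exp (-(μ * (2 - p)) * β u ω)) : X t = 0 := by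
  obtain ⟨Z, hZ, hXZ⟩ := hX
  have hanti := hZ.antitoneOn_norm hA hβ hl hp0 hstrict
  have hZT : ‖Z (max s T)‖ = 0 := by
    refine eq_zero_of_local_decay (N := fun t => ‖Z (max s t)‖) (p := p) (s := s)
      (k := fun u => 2 * l * Real.exp (-(μ * (2 - p)) * β u ω)) hp2
      (hZ.1.comp_continuous (by fun_prop) fun r => mem_Ici.2 (le_max_left _ _)).norm
      (fun _ => norm_nonneg _) (by fun_prop) hp0 hanti (fun t ht => ?_) hsT ?_
    · filter_upwards [hZ.eventually_norm_sq_le hA hβ hp0 hstrict ht, self_mem_nhdsWithin]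
        with r hr (htr : t < r)
      rwa [max_eq_right ht, max_eq_right (ht.trans htr.le)]
    · rw [max_self, hZ.initial_value hι, norm_smul,
        Real.norm_of_nonneg (r := brownianMultiplier μ β s ω) (Real.exp_pos _).le,
        intervalIntegral.integral_const_mul]
      exact hT.trans_eq (by ring)
  have hZt : ‖Z (max s t)‖ ≤ 0 := hZT ▸ hanti hsT (hsT.trans hTt) hTt
  rw [max_eq_right (hsT.trans hTt), norm_le_zero_iff] at hZt
  rw [hXZ t (hsT.trans hTt), hZt, smul_zero]

/-- Uniqueness is the case of extinction time `T = s`; no monotonicity of the drift is used. -/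
theorem isSolutionPath_zero_iff (hA : IsSingularDrift ι α C₁ C₂ c f A) (hι : DenseRange ι)
    (hβ : Continuous fun t => β t ω) (hl : 0 < l) (hp0 : 0 < p) (hp2 : p < 2)
    (hstrict : ∀ t v, A t v ω v ≤ -l * ‖ι v‖ ^ p) (h0 : ∀ t, A t 0 ω = 0) :
    IsSolutionPath ι α μ β A ω s 0 X ↔ ∀ t, s ≤ t → X t = 0 := by
  refine ⟨fun hX t ht => hX.eq_zero_of_le hA hι hβ hl hp0 hp2 hstrict le_rfl ht ?_, fun hX => ?_⟩
  · simp [Real.zero_rpow (sub_pos.2 hp2).ne']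
  · have hF : ∀ r, transformedDrift μ β A ω r 0 = 0 := fun r => by simp [transformedDrift, h0]
    refine ⟨fun _ => 0, ⟨continuousOn_const, fun _ => 0, ?_, ?_, ?_, ?_⟩, ?_⟩
    · simp
    · exact fun T => MemLp.zero
    · simp [hF]
    · simp [hF]
    · simpa using hX

end Paths

/-! ### The forward attractor -/

theorem isForwardAttractor_zero {Ω H : Type*} [MeasurableSpace Ω] [NormedAddCommGroup H]
    {P : Measure Ω} {θ : ℝ → Ω → Ω} {φ : ℝ → Ω → H → H}
    (hinv : ∀ ω t, 0 ≤ t → φ t ω '' {0} = {0})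
    (habs : ∀ᵐ ω ∂P, ∀ B : Set H, Bornology.IsBounded B →
      ∀ᶠ t in atTop, φ t ω '' B ⊆ {0}) :
    IsForwardAttractor P θ φ fun _ => {0} := by
  refine ⟨fun x => measurable_const, ?_⟩
  filter_upwards [habs] with ω hω
  refine ⟨singleton_nonempty _, isCompact_singleton, hinv ω, fun B hB => ?_⟩
  refine tendsto_const_nhds.congr' ?_
  filter_upwards [hω B hB] with t ht
  refine (le_antisymm (iSup₂_le fun y hy => ?_) bot_le).symm
  rw [ht hy]
  simp

theorem mainTheorem3
    {Ω : Type*} [MeasurableSpace Ω] (P : Measure Ω) [IsProbabilityMeasure P]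
    (θ : ℝ → Ω → Ω) (hθ : IsMetricDynamicalSystem P θ)
    (β : ℝ → Ω → ℝ) (hβ : IsTwoSidedBrownianMotion P θ β) (μ : ℝ)
    {V : Type*} [NormedAddCommGroup V] [NormedSpace ℝ V] [CompleteSpace V]
    [MeasurableSpace V] [BorelSpace V]
    {H : Type*} [NormedAddCommGroup H] [InnerProductSpace ℝ H] [CompleteSpace H]
    [TopologicalSpace.SeparableSpace H]
    (ι : V →L[ℝ] H) (hι : IsGelfandEmbedding ι)
    (A : ℝ → V → Ω → StrongDual ℝ V)
    (hAmeas : Measurable (fun z : ℝ × V × Ω => A z.1 z.2.1 z.2.2))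
    (hAstat : ∀ t v ω, A t v ω = A 0 v (θ t ω))
    (α : ℝ) (C₁ C₂ c f : ℝ → Ω → ℝ) (hA : IsSingularDrift ι α C₁ C₂ c f A)
    (l : Ω → ℝ) (hl : ∀ ω, 0 < l ω) (p : ℝ) (hp0 : 0 < p) (hp2 : p < 2)
    (hstrict : ∀ t v ω, A t v ω v ≤ -l ω * ‖ι v‖ ^ p) :
    (∃ t₀ : ℝ → ℝ → Ω → ℝ, ∀ᵐ ω ∂P, ∀ s : ℝ,
      -- every solution started at time `s` in a ball vanishes after a common finite time
      (∀ (R : ℝ) (x : H) (X : ℝ → H), ‖x‖ ≤ R → IsSolutionPath ι α μ β A ω s x X →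
        ∀ t, s ≤ t → t₀ R s ω ≤ t → X t = 0) ∧
      -- `{0}` is forward-absorbing for the associated flow
      ∀ S : ℝ → ℝ → Ω → H → H, IsSolutionFlow ι α μ β A S →
        ∀ B : Set H, Bornology.IsBounded B →
          ∀ t, s ≤ t → t₀ (setNorm B) s ω ≤ t → S t s ω '' B ⊆ {0}) ∧
    ((∀ t ω, A t 0 ω = 0) →
      -- the zero path is the solution started in `0`
      (∀ ω s (X : ℝ → H), IsSolutionPath ι α μ β A ω s 0 X ↔ ∀ t, s ≤ t → X t = 0) ∧
      ∀ S : ℝ → ℝ → Ω → H → H, IsSolutionFlow ι α μ β A S →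
        -- `{0}` is invariant, and a forward attractor for `φ t ω = S t 0 ω`
        (∀ ω s t, s ≤ t → S t s ω '' {0} = {0}) ∧
        IsForwardAttractor P θ (fun t ω => S t 0 ω) (fun _ => {0})) := by
  have hβc := hβ.continuous_path
  have hflow : ∀ {S : ℝ → ℝ → Ω → H → H}, IsSolutionFlow ι α μ β A S → ∀ {B : Set H},
      Bornology.IsBounded B → ∀ {ω s t}, (∀ x X, ‖x‖ ≤ setNorm B →
        IsSolutionPath ι α μ β A ω s x X → X t = 0) → S t s ω '' B ⊆ {0} := by
    rintro S hS B hB ω s t h _ ⟨x, hx, rfl⟩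
    refine h x _ ?_ (hS ω s x)
    obtain ⟨M, hM⟩ := hB.exists_norm_le
    exact le_csSup ⟨M, by rintro _ ⟨y, hy, rfl⟩; exact hM y hy⟩ (mem_image_of_mem _ hx)
  have hext : ∀ᵐ ω ∂P, ∀ s R, ∃ T, ∀ (x : H) (X : ℝ → H), ‖x‖ ≤ R →
      IsSolutionPath ι α μ β A ω s x X → ∀ t, s ≤ t → T ≤ t → X t = 0 := by
    filter_upwards [hβ.ae_not_integrableOn_exp hθ (-(μ * (2 - p)))] with ω hω s R
    have := hβc ω
    have hκ : 0 < (2 - p) * l ω := mul_pos (by linarith) (hl ω)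
    obtain ⟨T, hsT, hT⟩ := exists_le_intervalIntegral_of_not_integrableOn (by fun_prop)
      (fun r => (Real.exp_pos _).le) (hω s)
      ((brownianMultiplier μ β s ω * R) ^ (2 - p) / ((2 - p) * l ω))
    refine ⟨T, fun x X hx hX t _ hTt => hX.eq_zero_of_le hA hι.denseRange (hβc ω) (hl ω) hp0 hp2
      (fun t v => hstrict t v ω) hsT hTt ?_⟩
    rw [div_le_iff₀' hκ] at hT
    refine le_trans ?_ hT
    have hm : 0 ≤ brownianMultiplier μ β s ω := (Real.exp_pos _).le
    exact Real.rpow_le_rpow (by positivity) (by gcongr) (by linarith)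
  -- the extinction time exists for almost every `ω` only; on the null set its value is irrelevant
  refine ⟨⟨fun R s ω => Classical.epsilon fun T => ∀ (x : H) (X : ℝ → H), ‖x‖ ≤ R →
    IsSolutionPath ι α μ β A ω s x X → ∀ t, s ≤ t → T ≤ t → X t = 0, ?_⟩, fun h0 => ?_⟩
  · filter_upwards [hext] with ω hω s
    refine ⟨fun R x X hx hX => Classical.epsilon_spec (hω s R) x X hx hX,
      fun S hS B hB t hst ht => hflow hS hB fun x X hx hX => ?_⟩
    exact Classical.epsilon_spec (hω s (setNorm B)) x X hx hX t hst ht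
  · have hzero : ∀ ω s (X : ℝ → H), IsSolutionPath ι α μ β A ω s 0 X ↔ ∀ t, s ≤ t → X t = 0 :=
      fun ω s X => isSolutionPath_zero_iff hA hι.denseRange (hβc ω) (hl ω) hp0 hp2
        (fun t v => hstrict t v ω) fun t => h0 t ω
    refine ⟨hzero, fun S hS => ?_⟩
    have hinv : ∀ ω s t, s ≤ t → S t s ω '' {0} = {0} := fun ω s t hst => by
      rw [image_singleton, (hzero ω s _).1 (hS ω s 0) t hst]
    refine ⟨hinv, isForwardAttractor_zero (fun ω t ht => hinv ω 0 t ht) ?_⟩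
    filter_upwards [hext] with ω hω B hB
    obtain ⟨T, hT⟩ := hω 0 (setNorm B)
    filter_upwards [eventually_ge_atTop 0, eventually_ge_atTop T] with t h0t hTt
    exact hflow hS hB fun x X hx hX => hT x X hx hX t h0t hTt
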